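/- Let $G$ be a finite group of odd order that is metanilpotent, i.e. $G$ has a nilpotent normal subgroup $N$ such that $G/N$ is nilpotent. Let $n \ge 0$, let $p_1,\dots,p_n$ be distinct primes, and for each $i$ let $P_i$ be a Sylow $p_i$-subgroup of $G$. Write $P^g = g^{-1}Pg$, let $F(G)$ denote the Fitting subgroup of $G$ (the largest nilpotent normal subgroup of $G$), and let $O_p(G)$ denote the intersection of all Sylow $p$-subgroups of $G$. Then there exists a single element $x \in F(G)$ such that, for every $i = 1,\dots,n$, $$P_i \cap P_i^x = O_{p_i}(G).$$ In particular, for every $i$, the subgroup $P_i \cap P_i^x$ is minimal with respect to inclusion in the set $\{P_i \cap P_i^g : g \in G\}$. -/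

import Mathlib

open scoped Pointwise

/-- A group is metanilpotent if it has a nilpotent normal subgroup with nilpotent quotient. -/
def IsMetanilpotent (G : Type*) [Group G] : Prop :=
  ∃ (N : Subgroup G) (_ : N.Normal), Group.IsNilpotent N ∧ Group.IsNilpotent (G ⧸ N)

/-- The Fitting subgroup `F(G)`: the subgroup generated by all nilpotent normal subgroups. For a
finite group it is the largest nilpotent normal subgroup. -/
def fittingSubgroup (G : Type*) [Group G] : Subgroup G :=
  sSup {N : Subgroup G | N.Normal ∧ Group.IsNilpotent N}

/-- The `p`-core `O_p(G)`: the intersection of all Sylow `p`-subgroups of `G`. -/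
def pCore (p : ℕ) (G : Type*) [Group G] : Subgroup G :=
  ⨅ P : Sylow p G, (P : Subgroup G)

/-- The conjugate `H^x = x⁻¹ H x` of a subgroup. -/
def conjSubgroup {G : Type*} [Group G] (H : Subgroup G) (x : G) : Subgroup G :=
  MulAut.conj x⁻¹ • H

theorem mem_conjSubgroup {G : Type*} [Group G] (H : Subgroup G) (x g : G) :
    g ∈ conjSubgroup H x ↔ ∃ h ∈ H, x⁻¹ * h * x = g := by
  simp [conjSubgroup, Subgroup.mem_smul_pointwise_iff_exists]

/-! Let `N` be nilpotent and normal with nilpotent quotient. If `u` lies in `P` and in `P^x` with `x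
∈ N`, then [u, x] is a p-element. The aim is one `x`, good for all primes at once, for which this
forces [u, N] into a Sylow p-subgroup of `N`, hence into O_p(G). A Frattini argument
(`Sylow.mem_pCore_of_commutator_mem`) then puts `u` itself in O_p(G). By coprime action, [u, N]
needs control only in the abelianization of `N`, on which `G` acts through a nilpotent group
(`exists_regular_conj`).

What is needed there is a regular orbit theorem (`exists_regular`): when a nilpotent group `A` of
odd order acts coprimely on an abelian group `V` of odd order, some vector has the kernel as its
stabilizer. It is applied to each primary part of the abelianization, with a Hall subgroup acting,
and the vectors are added.

The orbit theorem goes by induction on the order of `V`, with `A` made faithful. If a nontrivial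
central element fixes a nonzero vector, `V` splits. Otherwise the center acts fixed-point-freely; if
`A` is abelian, any nonzero vector works. If not, oddness yields a noncentral `c` of prime order
that is central modulo the center. Then `V` is the direct sum of the fixed spaces of the conjugates
of `c`, and a regular vector is assembled from translates of one vector, with signs that elements of
odd order cannot mix. -/

/-! ### Cyclic normal subgroups of p-groups of odd order -/

/-- If `p` is an odd prime and `k ≡ 1` mod `p`, then `1 + k + ⋯ + k ^ (p - 1) ≡ p` mod `p ^ 2`. -/
theorem Int.exists_geom_sum_eq_of_dvd_sub_one {p : ℕ} (hodd : Odd p) {k : ℤ}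
    (hk : (p : ℤ) ∣ k - 1) :
    ∃ t : ℤ, ∑ i ∈ Finset.range p, k ^ i = p * (1 + p * t) := by
  obtain ⟨l, hl⟩ := hk
  have hpow (i : ℕ) : ∃ t : ℤ, k ^ i = 1 + i * (p * l) + p ^ 2 * t := by
    induction i with
    | zero => exact ⟨0, by simp⟩
    | succ i ih =>
      obtain ⟨t, ht⟩ := ih
      refine ⟨i * l ^ 2 + t * (1 + p * l), ?_⟩
      rw [pow_succ, ht, show k = 1 + p * l by linarith]
      push_cast
      ring
  choose t ht using hpow
  obtain ⟨m, hm⟩ := hodd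
  -- Oddness enters here: it makes `p` divide 0 + 1 + ⋯ + (p - 1).
  have hsum : (∑ i ∈ Finset.range p, (i : ℤ)) = p * m := by
    have h := Finset.sum_range_id_mul_two p
    have h' : (∑ i ∈ Finset.range p, (i : ℤ)) * 2 = p * m * 2 := by
      have : ((∑ i ∈ Finset.range p, i) * 2 : ℕ) = p * m * 2 := by
        rw [h, show p - 1 = m * 2 by omega, mul_assoc]
      have := congrArg (fun n : ℕ => (n : ℤ)) this
      push_cast at this
      exact this
    exact mul_right_cancel₀ two_ne_zero h'
  refine ⟨m * l + ∑ i ∈ Finset.range p, t i, ?_⟩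
  simp_rw [ht, Finset.sum_add_distrib, ← Finset.sum_mul, ← Finset.mul_sum, hsum]
  simp
  ring

/-- Moving a `d` to the right past a power of `b` multiplies the exponent by `k`. -/
theorem mul_pow_eq_zpow_geom_sum_mul_pow {G : Type*} [Group G] {b d : G} {k : ℤ}
    (h : ∀ n : ℤ, d * b ^ n * d⁻¹ = b ^ (n * k)) (j : ℕ) :
    (b * d) ^ j = b ^ (∑ i ∈ Finset.range j, k ^ i) * d ^ j := by
  induction j with
  | zero => simp
  | succ j ih =>
    rw [pow_succ', ih, Finset.sum_range_succ', pow_succ' d]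
    have h1 := h (∑ i ∈ Finset.range j, k ^ i)
    rw [Finset.sum_mul] at h1
    simp_rw [← pow_succ] at h1
    rw [add_comm, zpow_add, ← h1]
    simp [mul_assoc]

namespace IsPGroup

variable {P : Type*} [Group P] {p : ℕ}

theorem eq_one_of_zpow_eq_one (hP : IsPGroup p P) {b : P} {t : ℤ}
    (h : b ^ (1 + p * t) = 1) : b = 1 := by
  obtain ⟨m, hm⟩ := hP b
  have hcop : IsCoprime (1 + p * t) ((p : ℤ) ^ m) := by
    apply IsCoprime.pow_right
    exact ⟨1, -t, by ring⟩
  obtain ⟨x, y, hxy⟩ := hcop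
  calc b = b ^ (x * (1 + p * t) + y * (p : ℤ) ^ m) := by rw [hxy, zpow_one]
    _ = (b ^ (1 + p * t)) ^ x * (b ^ (p ^ m)) ^ y := by
      rw [zpow_add, mul_comm x, mul_comm y, zpow_mul, zpow_mul, ← zpow_natCast b (p ^ m)]
      push_cast
      rfl
    _ = 1 := by rw [h, hm]; simp

variable [Fact p.Prime]

/-- An element of a `p`-group acts on a cyclic normal subgroup as a power map with exponent
congruent to `1` mod `p`. -/
theorem exists_conj_eq_zpow (hP : IsPGroup p P) {B : Subgroup P} [B.Normal] [IsCyclic B] (d : P) :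
    ∃ k : ℤ, (p : ℤ) ∣ k - 1 ∧ ∀ b ∈ B, d * b * d⁻¹ = b ^ k := by
  obtain ⟨k, hk⟩ := MonoidHom.map_cyclic (MulAut.conjNormal d : MulAut B).toMonoidHom
  replace hk : ∀ b ∈ B, d * b * d⁻¹ = b ^ k := fun b hb => by
    simpa [Subtype.ext_iff] using hk ⟨b, hb⟩
  obtain ⟨b, hb⟩ := IsCyclic.exists_generator (α := B)
  by_cases hb1 : b = 1
  · refine ⟨1, by simp, fun x hx => ?_⟩
    have := hb ⟨x, hx⟩
    simp [hb1] at this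
    simp [this]
  refine ⟨k, ?_, hk⟩
  have hpow (j : ℕ) : d ^ j * b * (d ^ j)⁻¹ = (b : P) ^ (k ^ j) := by
    induction j with
    | zero => simp
    | succ j ih =>
      rw [pow_succ k, zpow_mul, ← ih]
      have : d ^ (j + 1) * b * (d ^ (j + 1))⁻¹ = d ^ j * (d * b * d⁻¹) * (d ^ j)⁻¹ := by
        group
      rw [this, hk _ b.2, conj_zpow]
  obtain ⟨m, hm⟩ := hP d
  have hcomm := hpow (p ^ m)
  rw [hm, one_mul, inv_one, mul_one] at hcomm
  have h1 : (b : P) ^ (k ^ p ^ m - 1) = 1 := by rw [zpow_sub, ← hcomm]; simp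
  -- `p` divides the order of `b`; Fermat then reduces `k ^ p ^ m` to `k` mod `p`.
  have h2 : (p : ℤ) ∣ k ^ p ^ m - 1 :=
    (Int.natCast_dvd_natCast.mpr (hP.dvd_orderOf (g := (b : P)) (by simpa using hb1))).trans
      (orderOf_dvd_iff_zpow_eq_one.mpr h1)
  rw [← ZMod.intCast_zmod_eq_zero_iff_dvd] at h2 ⊢
  push_cast at h2 ⊢
  rwa [ZMod.pow_card_pow] at h2

variable [Finite P]

/-- Cauchy's theorem in the center of `P ⧸ B`, which is nontrivial. -/
theorem exists_central_mod (hP : IsPGroup p P) {B : Subgroup P} [B.Normal] (hB : B ≠ ⊤) :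
    ∃ d ∉ B, d ^ p ∈ B ∧ ∀ g, g * d * g⁻¹ * d⁻¹ ∈ B := by
  have : Nontrivial (P ⧸ B) := QuotientGroup.nontrivial_iff.mpr hB
  have hQ : IsPGroup p (P ⧸ B) := hP.to_quotient B
  have := hQ.center_nontrivial
  have hdvd : p ∣ Nat.card (Subgroup.center (P ⧸ B)) :=
    (hQ.to_subgroup _).card_eq_or_dvd.resolve_left (Finite.one_lt_card).ne'
  obtain ⟨⟨x, hx⟩, hxo⟩ := exists_prime_orderOf_dvd_card' p hdvd
  obtain ⟨d, rfl⟩ := QuotientGroup.mk_surjective x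
  have hne : (d : P ⧸ B) ≠ 1 := by
    intro h
    have : (⟨(d : P ⧸ B), hx⟩ : Subgroup.center (P ⧸ B)) = 1 := Subtype.ext h
    rw [this, orderOf_one] at hxo
    exact (Fact.out : p.Prime).one_lt.ne hxo
  refine ⟨d, fun h => hne ((QuotientGroup.eq_one_iff d).mpr h), ?_, fun g => ?_⟩
  · have := pow_orderOf_eq_one (⟨(d : P ⧸ B), hx⟩ : Subgroup.center (P ⧸ B))
    rw [hxo, Subtype.ext_iff] at this
    rw [← QuotientGroup.eq_one_iff]
    simpa using this
  · rw [← QuotientGroup.eq_one_iff]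
    have := Subgroup.mem_center_iff.mp hx g
    simp only [QuotientGroup.mk_mul, QuotientGroup.mk_inv]
    rw [this]
    simp

/-- A noncyclic `p`-group, `p` odd, has a cyclic normal subgroup `B` and an element `d ∉ B` of
order `p` whose commutators all lie in the `p`-torsion of `B`. -/
theorem exists_order_prime_of_not_isCyclic (hP : IsPGroup p P) (hodd : Odd p)
    (hnc : ¬ IsCyclic P) :
    ∃ (B : Subgroup P), B.Normal ∧ IsCyclic B ∧ B ≠ ⊥ ∧ ∃ d ∉ B, d ^ p = 1 ∧
      ∀ g, g * d * g⁻¹ * d⁻¹ ∈ B ∧ (g * d * g⁻¹ * d⁻¹) ^ p = 1 := by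
  obtain ⟨B, hB⟩ := (Set.toFinite {B : Subgroup P | B.Normal ∧ IsCyclic B}).exists_maximal
    ⟨⊥, inferInstance, inferInstance⟩
  obtain ⟨hBn, hBc⟩ := hB.prop
  have hBtop : B ≠ ⊤ := by
    rintro rfl
    exact hnc (isCyclic_of_surjective _ (Subgroup.topEquiv (G := P)).surjective)
  obtain ⟨d, hdB, hdp, hdc⟩ := hP.exists_central_mod hBtop
  obtain ⟨k, hk1, hk⟩ := hP.exists_conj_eq_zpow (B := B) d
  obtain ⟨t, ht⟩ := Int.exists_geom_sum_eq_of_dvd_sub_one hodd hk1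
  obtain ⟨b, hb⟩ := IsCyclic.exists_generator (α := B)
  have hgen : ∀ x ∈ B, ∃ n : ℤ, (b : P) ^ n = x := fun x hx => by
    obtain ⟨n, hn⟩ := Subgroup.mem_zpowers_iff.mp (hb ⟨x, hx⟩)
    exact ⟨n, by simpa using congrArg Subtype.val hn⟩
  obtain ⟨s, hs⟩ := hgen _ hdp
  -- Otherwise `⟨d⟩` would be a cyclic normal subgroup strictly larger than `B`.
  have hbd : (b : P) ∉ Subgroup.zpowers d := fun hbd => by
    have hBd : B ≤ Subgroup.zpowers d := fun x hx => by
      obtain ⟨n, rfl⟩ := hgen x hx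
      exact Subgroup.zpow_mem _ hbd _
    have hn : (Subgroup.zpowers d).Normal := by
      refine ⟨fun x hx g => ?_⟩
      obtain ⟨n, rfl⟩ := Subgroup.mem_zpowers_iff.mp hx
      rw [← conj_zpow]
      refine Subgroup.zpow_mem _ ?_ _
      have := Subgroup.mul_mem _ (hBd (hdc g)) (Subgroup.mem_zpowers d)
      simpa using this
    exact hdB (hB.le_of_ge ⟨hn, inferInstance⟩ hBd (Subgroup.mem_zpowers d))
  have hps : (p : ℤ) ∣ s := by
    by_contra hps
    refine hbd ?_
    obtain ⟨m, hm⟩ := hP (b : P)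
    have hcop : IsCoprime s ((p : ℤ) ^ m) := by
      apply IsCoprime.pow_right
      rw [isCoprime_comm, Prime.coprime_iff_not_dvd (Nat.prime_iff_prime_int.mp Fact.out)]
      exact hps
    obtain ⟨x, y, hxy⟩ := hcop
    have : (b : P) = (d ^ p) ^ x := by
      calc (b : P) = (b : P) ^ (x * s + y * (p : ℤ) ^ m) := by rw [hxy, zpow_one]
        _ = ((b : P) ^ s) ^ x * ((b : P) ^ (p ^ m)) ^ y := by
          rw [zpow_add, mul_comm x, mul_comm y, zpow_mul, zpow_mul, ← zpow_natCast _ (p ^ m)]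
          push_cast
          rfl
        _ = _ := by rw [hs, hm]; simp
    rw [this]
    exact Subgroup.zpow_mem _ (Subgroup.pow_mem _ (Subgroup.mem_zpowers d) _) _
  obtain ⟨s', rfl⟩ := hps
  have hformula : ∀ x ∈ B, ∀ e : P, (∀ y ∈ B, e * y * e⁻¹ = y ^ k) →
      (x * e) ^ p = (x ^ p) ^ (1 + p * t) * e ^ p := by
    intro x hx e he
    rw [mul_pow_eq_zpow_geom_sum_mul_pow (k := k)
      (fun n => by rw [he _ (B.zpow_mem hx n), zpow_mul]), ht, zpow_mul, zpow_natCast]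
  -- The exponent is that of `(b ^ u * d) ^ p`; `u` comes from inverting `1 + p * t` modulo a power
  -- of `p` that kills `b`.
  obtain ⟨u, hu⟩ : ∃ u : ℤ, (b : P) ^ (u * (p * (1 + p * t)) + p * s') = 1 := by
    obtain ⟨m, hm⟩ := hP (b : P)
    have hcop : IsCoprime (1 + p * t) ((p : ℤ) ^ m) := by
      apply IsCoprime.pow_right
      exact ⟨1, -t, by ring⟩
    obtain ⟨x, y, hxy⟩ := hcop
    refine ⟨-s' * x, ?_⟩
    have : -s' * x * (p * (1 + p * t)) + p * s' = (p ^ m : ℕ) * (y * p * s') := by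
      push_cast
      linear_combination (-(p : ℤ) * s') * hxy
    rw [this, zpow_mul, zpow_natCast, hm, one_zpow]
  have hbu : (b : P) ^ u ∈ B := B.zpow_mem b.2 u
  have hcomm : ∀ x ∈ B, ∀ y ∈ B, x * y = y * x := fun x hx y hy =>
    congrArg Subtype.val ((IsCyclic.isMulCommutative (α := B)).is_comm.comm
      (⟨x, hx⟩ : B) ⟨y, hy⟩)
  have he : ∀ y ∈ B, ((b : P) ^ u * d) * y * ((b : P) ^ u * d)⁻¹ = y ^ k := by
    intro y hy
    have : ((b : P) ^ u * d) * y * ((b : P) ^ u * d)⁻¹ =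
        (b : P) ^ u * (d * y * d⁻¹) * ((b : P) ^ u)⁻¹ := by group
    rw [this, hk y hy, hcomm _ hbu _ (B.zpow_mem hy k)]
    group
  have hd1 : ((b : P) ^ u * d) ^ p = 1 := by
    rw [hformula _ hbu _ hk, ← hs, ← zpow_natCast, ← zpow_mul, ← zpow_mul, ← zpow_add, ← hu]
  have hdB' : ∀ g, g * ((b : P) ^ u * d) * g⁻¹ * ((b : P) ^ u * d)⁻¹ ∈ B := by
    intro g
    have : g * ((b : P) ^ u * d) * g⁻¹ * ((b : P) ^ u * d)⁻¹ =
      (g * (b : P) ^ u * g⁻¹) * (g * d * g⁻¹ * d⁻¹) * ((b : P) ^ u)⁻¹ := by group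
    rw [this]
    exact B.mul_mem (B.mul_mem (hBn.conj_mem _ hbu g) (hdc g)) (B.inv_mem hbu)
  have hBbot : B ≠ ⊥ := by
    rintro rfl
    exact hbd (by rw [Subgroup.mem_bot.mp b.2]; exact one_mem _)
  refine ⟨B, hBn, hBc, hBbot, (b : P) ^ u * d, fun h => hdB ?_, hd1, fun g => ⟨hdB' g, ?_⟩⟩
  · simpa using B.mul_mem (B.inv_mem hbu) h
  -- The commutator times `b ^ u * d` is a conjugate of `b ^ u * d`, so its `p`-th power is trivial.
  · have h1 := hformula _ (hdB' g) _ he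
    rw [hd1, mul_one, inv_mul_cancel_right, conj_pow, hd1] at h1
    exact hP.eq_one_of_zpow_eq_one (t := t) (by rw [← h1]; simp)

end IsPGroup

/-! ### Nilpotent groups through their Sylow subgroups -/

theorem Subgroup.eq_top_of_sylow_le {G : Type*} [Group G] [Finite G] {H : Subgroup G}
    (h : ∀ (p : ℕ) [Fact p.Prime] (P : Sylow p G), (P : Subgroup G) ≤ H) : H = ⊤ := by
  rw [← Subgroup.index_eq_one, Nat.eq_one_iff_not_exists_prime_dvd]
  intro p hp hdvd
  have : Fact p.Prime := ⟨hp⟩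
  obtain ⟨P⟩ : Nonempty (Sylow p G) := inferInstance
  exact P.not_dvd_index (hdvd.trans (Subgroup.index_dvd_of_le (h p P)))

namespace Sylow

variable {G : Type*} [Group G] [Finite G] [Group.IsNilpotent G] {p : ℕ} [Fact p.Prime]

theorem eq_of_isNilpotent (P Q : Sylow p G) : P = Q := by
  have := P.unique_of_normal inferInstance
  exact Subsingleton.elim P Q

theorem commute_of_ne {q : ℕ} [Fact q.Prime] (hpq : p ≠ q) (P : Sylow p G) (Q : Sylow q G)
    {x y : G} (hx : x ∈ P) (hy : y ∈ Q) : Commute x y :=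
  Subgroup.commute_of_normal_of_disjoint _ _ inferInstance inferInstance
    (IsPGroup.disjoint_of_ne p q hpq _ _ P.isPGroup' Q.isPGroup') x y hx hy

theorem mem_center_of_isNilpotent {P : Sylow p G} {x : G} (hx : x ∈ P)
    (h : ∀ y ∈ P, Commute x y) : x ∈ Subgroup.center G := by
  have : Subgroup.centralizer {x} = ⊤ := by
    refine Subgroup.eq_top_of_sylow_le fun q _ Q y hy => ?_
    rw [Subgroup.mem_centralizer_singleton_iff]
    by_cases hpq : p = q
    · subst hpq
      exact (h y (P.eq_of_isNilpotent Q ▸ hy)).symm.eq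
    · exact (commute_of_ne hpq P Q hx hy).symm.eq
  rw [Subgroup.mem_center_iff]
  intro g
  exact Subgroup.mem_centralizer_singleton_iff.mp (this ▸ Subgroup.mem_top g)

end Sylow

/-- In a nonabelian nilpotent group of odd order whose center is cyclic (expressed through its
elements of prime order), some noncentral element of prime order is central modulo the center. -/
theorem Group.IsNilpotent.exists_noncentral_order_prime {A : Type*} [Group A] [Finite A]
    [Group.IsNilpotent A] (hodd : Odd (Nat.card A)) (hnc : Subgroup.center A ≠ ⊤)
    (hz : ∀ r : ℕ, r.Prime → ∀ x ∈ Subgroup.center A, ∀ y ∈ Subgroup.center A,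
      x ^ r = 1 → y ^ r = 1 → x ≠ 1 → y ∈ Subgroup.zpowers x) :
    ∃ r : ℕ, r.Prime ∧ ∃ c ∉ Subgroup.center A, c ^ r = 1 ∧
      ∀ g, g * c * g⁻¹ * c⁻¹ ∈ Subgroup.center A ∧ (g * c * g⁻¹ * c⁻¹) ^ r = 1 := by
  obtain ⟨p, hp, P, hP⟩ : ∃ p, ∃ _ : Fact p.Prime, ∃ P : Sylow p A,
      ¬ (P : Subgroup A) ≤ Subgroup.center A := by
    by_contra! h
    exact hnc (Subgroup.eq_top_of_sylow_le fun p hp P => h p hp P)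
  have hPnc : ¬ IsCyclic P := fun hcyc => hP fun x hx =>
    Sylow.mem_center_of_isNilpotent hx fun y hy => by
      have := (IsCyclic.isMulCommutative (α := P)).is_comm.comm (⟨x, hx⟩ : P) ⟨y, hy⟩
      exact congrArg Subtype.val this
  have hpodd : Odd p := by
    refine hodd.of_dvd_nat (dvd_trans ?_ (Subgroup.card_subgroup_dvd_card (P : Subgroup A)))
    refine (P.isPGroup'.card_eq_or_dvd).resolve_left fun h => hP ?_
    rw [Subgroup.card_eq_one.mp h]
    exact bot_le
  obtain ⟨B, hBn, hBc, hBbot, d, hdB, hd1, hdc⟩ :=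
    P.isPGroup'.exists_order_prime_of_not_isCyclic hpodd hPnc
  -- Elements of `P` act on `B` by exponents congruent to 1 mod `p`, hence trivially on its
  -- `p`-torsion.
  have hcent : ∀ x ∈ B, x ^ p = 1 → (x : A) ∈ Subgroup.center A := by
    intro x hx hxp
    refine Sylow.mem_center_of_isNilpotent x.2 fun y hy => ?_
    obtain ⟨k, ⟨l, hl⟩, hk⟩ := P.isPGroup'.exists_conj_eq_zpow (B := B) ⟨y, hy⟩
    have h1 := hk x hx
    rw [show k = p * l + 1 by linarith, zpow_add, zpow_mul, zpow_natCast, hxp, one_zpow, one_mul,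
      zpow_one, mul_inv_eq_iff_eq_mul] at h1
    exact (congrArg Subtype.val h1).symm
  obtain ⟨z, hzB, hz1, hzp⟩ : ∃ z ∈ B, z ≠ 1 ∧ z ^ p = 1 := by
    have hdvd : p ∣ Nat.card B := (P.isPGroup'.to_subgroup B).card_eq_or_dvd.resolve_left
      fun h => hBbot (Subgroup.card_eq_one.mp h)
    obtain ⟨z, hz⟩ := exists_prime_orderOf_dvd_card' p hdvd
    refine ⟨z, z.2, fun h => ?_, ?_⟩
    · rw [OneMemClass.coe_eq_one] at h
      rw [h, orderOf_one] at hz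
      exact hp.out.one_lt.ne hz
    · exact_mod_cast orderOf_dvd_iff_pow_eq_one.mp hz.dvd
  refine ⟨p, hp.out, d, fun hdZ => hdB ?_, by exact_mod_cast hd1, fun g => ?_⟩
  · obtain ⟨n, hn⟩ := Subgroup.mem_zpowers_iff.mp (hz p hp.out z (hcent z hzB hzp) d hdZ
      (by exact_mod_cast hzp) (by exact_mod_cast hd1) (by exact_mod_cast hz1))
    have : d = z ^ n := Subtype.ext (by simpa using hn.symm)
    rw [this]
    exact B.zpow_mem hzB n
  -- `hdc` only treats `g` in `P`. The good `g` form a subgroup, which also contains the other Sylow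
  -- subgroups because they commute with `d`.
  · let H : Subgroup A :=
      { carrier := {g | g * d * g⁻¹ * (d : A)⁻¹ ∈ Subgroup.center A ∧
          (g * d * g⁻¹ * (d : A)⁻¹) ^ p = 1}
        one_mem' := by simp [one_mem]
        mul_mem' := by
          rintro a b ⟨ha, hap⟩ ⟨hb, hbp⟩
          have : a * b * d * (a * b)⁻¹ * (d : A)⁻¹ =
              (b * d * b⁻¹ * (d : A)⁻¹) * (a * d * a⁻¹ * (d : A)⁻¹) := by
            have h1 : a * b * d * (a * b)⁻¹ * (d : A)⁻¹ =
              (a * (b * d * b⁻¹ * (d : A)⁻¹)) * d * a⁻¹ * (d : A)⁻¹ := by group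
            rw [h1, Subgroup.mem_center_iff.mp hb a]
            group
          rw [Set.mem_ofPred_eq, this]
          refine ⟨mul_mem hb ha, ?_⟩
          rw [Commute.mul_pow (Subgroup.mem_center_iff.mp ha _), hap, hbp, one_mul]
        inv_mem' := by
          rintro a ⟨ha, hap⟩
          have : a⁻¹ * d * a⁻¹⁻¹ * (d : A)⁻¹ = (a * d * a⁻¹ * (d : A)⁻¹)⁻¹ := by
            have h1 : a⁻¹ * d * a⁻¹⁻¹ * (d : A)⁻¹ =
              a⁻¹ * ((a * d * a⁻¹ * (d : A)⁻¹)⁻¹ * a) := by group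
            rw [h1, ← Subgroup.mem_center_iff.mp (inv_mem ha) a, inv_mul_cancel_left]
          rw [Set.mem_ofPred_eq, this]
          exact ⟨inv_mem ha, by rw [inv_pow, hap, inv_one]⟩ }
    have hH : H = ⊤ := by
      refine Subgroup.eq_top_of_sylow_le fun q _ Q y hy => ?_
      by_cases hpq : p = q
      · subst hpq
        have hyP : y ∈ P := P.eq_of_isNilpotent Q ▸ hy
        have := hdc ⟨y, hyP⟩
        refine ⟨hcent _ this.1 this.2, ?_⟩
        have h2 := congrArg Subtype.val this.2
        push_cast at h2
        exact h2
      · have := (Sylow.commute_of_ne hpq P Q d.2 hy).eq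
        have h1 : y * d * y⁻¹ * (d : A)⁻¹ = 1 := by rw [← this]; group
        exact ⟨by rw [h1]; exact one_mem _, by rw [h1, one_pow]⟩
    exact (hH ▸ Subgroup.mem_top g : g ∈ H)

/-! ### Norm maps of cyclic groups -/

theorem eq_zero_of_nsmul_eq_zero_of_coprime {V : Type*} [AddCommGroup V] {n : ℕ}
    (hn : (Nat.card V).Coprime n) {v : V} (h : n • v = 0) : v = 0 :=
  (nsmulCoprime hn).injective (by simpa using h)

theorem conj_pow_eq_mul_pow {A : Type*} [Group A] {c z g₀ : A} (hz : z ∈ Subgroup.center A)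
    (hg₀ : g₀ * c * g₀⁻¹ = c * z) (j : ℕ) : g₀ ^ j * c * (g₀ ^ j)⁻¹ = c * z ^ j := by
  induction j with
  | zero => simp
  | succ j ih =>
    calc g₀ ^ (j + 1) * c * (g₀ ^ (j + 1))⁻¹ = g₀ ^ j * (g₀ * c * g₀⁻¹) * (g₀ ^ j)⁻¹ := by group
      _ = g₀ ^ j * c * z ^ 1 * (g₀ ^ j)⁻¹ := by rw [hg₀, pow_one]; group
      _ = _ := by
        rw [pow_one, mul_assoc, ← Subgroup.mem_center_iff.mp hz, ← mul_assoc, ih, pow_succ,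
          mul_assoc]

section NormMap

variable {A V : Type*} [Group A] [AddCommGroup V] [DistribMulAction A V]

/-- The sum of the translates of `v` under the first `n` powers of `a`. -/
def powSum (a : A) (n : ℕ) (v : V) : V := ∑ k ∈ Finset.range n, a ^ k • v

theorem powSum_add (a : A) (n : ℕ) (v w : V) :
    powSum a n (v + w) = powSum a n v + powSum a n w := by
  simp [powSum, Finset.sum_add_distrib]

theorem powSum_sum {ι : Type*} (a : A) (n : ℕ) (s : Finset ι) (f : ι → V) :
    powSum a n (∑ i ∈ s, f i) = ∑ i ∈ s, powSum a n (f i) := by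
  simp only [powSum, Finset.smul_sum]
  exact Finset.sum_comm

theorem powSum_of_fixed {a : A} (n : ℕ) {v : V} (h : a • v = v) : powSum a n v = n • v := by
  have (k : ℕ) : a ^ k • v = v := by
    induction k with
    | zero => simp
    | succ k ih => rw [pow_succ, mul_smul, h, ih]
  simp [powSum, this]

theorem smul_powSum {a : A} {n : ℕ} (h : a ^ n = 1) (v : V) :
    a • powSum a n v = powSum a n v := by
  have h1 := Finset.sum_range_succ' (fun k => a ^ k • v) n
  have h2 := Finset.sum_range_succ (fun k => a ^ k • v) n
  rw [h1, h, pow_zero, add_left_inj] at h2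
  rw [powSum, Finset.smul_sum, ← h2]
  simp [smul_smul, pow_succ']

theorem smul_powSum_conj (b a : A) (n : ℕ) (v : V) :
    b • powSum a n v = powSum (b * a * b⁻¹) n (b • v) := by
  simp [powSum, Finset.smul_sum, conj_pow, smul_smul]

/-- The norm of a vector is itself fixed by `a`. -/
theorem powSum_eq_zero {a : A} {n : ℕ} (h : a ^ n = 1) (hf : ∀ v : V, a • v = v → v = 0) (v : V) :
    powSum a n v = 0 :=
  hf _ (smul_powSum h v)

theorem powSum_congr {a b : A} (hb : b ∈ Subgroup.center A) (n : ℕ) {v : V}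
    (h : a • v = b • v) : powSum a n v = powSum b n v := by
  refine Finset.sum_congr rfl fun k hk => ?_
  clear hk
  induction k with
  | zero => simp
  | succ k ih =>
    have hbk := Subgroup.mem_center_iff.mp hb (a ^ k)
    rw [pow_succ, mul_smul, h, ← mul_smul, hbk, mul_smul, ih, ← mul_smul, ← pow_succ']

/-- For commuting `c`, `z` with `z ^ r = 1`, `r` prime, and `z` fixed-point-free, the maps
`powSum (c * z ^ j) r` add up to multiplication by `r`. -/
theorem sum_powSum_eq_nsmul {c z : A} (hcz : Commute c z) {r : ℕ} (hr : r.Prime)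
    (hzr : z ^ r = 1) (hz : ∀ v : V, z • v = v → v = 0) (v : V) :
    ∑ j ∈ Finset.range r, powSum (c * z ^ j) r v = r • v := by
  simp only [powSum]
  -- After swapping the sums, the `k`-th inner sum is `c ^ k` applied to a norm for `z ^ k`. It
  -- vanishes for `k ≠ 0`, since `z ^ k` generates `⟨z⟩`.
  rw [Finset.sum_comm, Finset.sum_eq_single_of_mem 0 (Finset.mem_range.mpr hr.pos)]
  · simp
  · intro k hk hk0
    have hcop : Nat.Coprime k r := by
      rw [Nat.coprime_comm, hr.coprime_iff_not_dvd]
      exact fun h => absurd (Nat.le_of_dvd (Nat.pos_of_ne_zero hk0) h)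
        (not_le.mpr (Finset.mem_range.mp hk))
    have hfix : ∀ w : V, z ^ k • w = w → w = 0 := by
      intro w hw
      refine hz w ?_
      have h1 : z ^ k ∈ MulAction.stabilizer A w := hw
      have h2 : z ^ r ∈ MulAction.stabilizer A w := by rw [hzr]; exact one_mem _
      have h3 : z ^ Nat.gcd k r ∈ MulAction.stabilizer A w := by
        rw [← zpow_natCast, Nat.gcd_eq_gcd_ab, zpow_add, zpow_mul, zpow_mul, zpow_natCast,
          zpow_natCast]
        exact mul_mem (zpow_mem h1 _) (zpow_mem h2 _)
      rw [hcop.gcd_eq_one, pow_one] at h3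
      exact h3
    have hpow : (z ^ k) ^ r = 1 := by rw [← pow_mul, mul_comm, pow_mul, hzr, one_pow]
    have h0 := powSum_eq_zero hpow hfix v
    calc ∑ j ∈ Finset.range r, (c * z ^ j) ^ k • v = c ^ k • powSum (z ^ k) r v := by
          rw [powSum, Finset.smul_sum]
          refine Finset.sum_congr rfl fun j _ => ?_
          rw [(hcz.pow_right j).mul_pow, mul_smul, ← pow_mul, mul_comm j k, pow_mul]
      _ = 0 := by rw [h0, smul_zero]

end NormMap

/-! ### Regular orbits for coprime actions -/

section RegularOrbit

variable {A V : Type*} [Group A] [AddCommGroup V] [DistribMulAction A V]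

/-- If a nontrivial central element has a nonzero fixed vector, then `V` splits, and suitable
vectors of the two summands add up to a suitable vector of `V`. -/
theorem exists_regular_of_central_fixed [FaithfulSMul A V]
    (hcop : (Nat.card V).Coprime (Nat.card A))
    (IH : ∀ U : AddSubgroup V, U ≠ ⊤ → (∀ a : A, ∀ u ∈ U, a • u ∈ U) →
      ∃ u ∈ U, ∀ a : A, a • u = u → ∀ w ∈ U, a • w = w)
    {z : A} (hz : z ∈ Subgroup.center A) (hz1 : z ≠ 1) {v₀ : V} (hv₀ : v₀ ≠ 0)
    (hzv₀ : z • v₀ = v₀) :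
    ∃ v : V, ∀ a : A, a • v = v → ∀ w : V, a • w = w := by
  set n := orderOf z with hn
  have hzn : z ^ n = 1 := pow_orderOf_eq_one z
  have hn0 {v : V} : n • v = 0 → v = 0 :=
    eq_zero_of_nsmul_eq_zero_of_coprime (hcop.coprime_dvd_right (orderOf_dvd_natCard z))
  have hcomm (a : A) (v : V) : z • a • v = a • z • v := by
    rw [← mul_smul, ← mul_smul, Subgroup.mem_center_iff.mp hz a]
  have hsum (a : A) (v : V) : powSum z n (a • v) = a • powSum z n v := by
    rw [smul_powSum_conj, Subgroup.mem_center_iff.mp hz a, mul_inv_cancel_right]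
  let U₁ : AddSubgroup V :=
    { carrier := {v | z • v = v}
      zero_mem' := smul_zero z
      add_mem' := fun {a b} ha hb => by
        rw [Set.mem_ofPred_eq] at *
        rw [smul_add, ha, hb]
      neg_mem' := fun {a} ha => by
        rw [Set.mem_ofPred_eq] at *
        rw [smul_neg, ha] }
  -- The two summands are the fixed space of `z` and the kernel of this norm; both are invariant
  -- because `z` is central.
  let N : V →+ V := AddMonoidHom.mk' (powSum z n) (powSum_add z n)
  have hU₁ : U₁ ≠ ⊤ := by
    intro h
    refine hz1 (FaithfulSMul.eq_of_smul_eq_smul (α := V) fun v => ?_)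
    rw [one_smul]
    exact (h ▸ AddSubgroup.mem_top v : v ∈ U₁)
  have hU₂ : N.ker ≠ ⊤ := by
    intro h
    have : powSum z n v₀ = 0 := (h ▸ AddSubgroup.mem_top v₀ : v₀ ∈ N.ker)
    rw [powSum_of_fixed n hzv₀] at this
    exact hv₀ (hn0 this)
  obtain ⟨u₁, hu₁, h₁⟩ := IH U₁ hU₁ fun a u hu => by
    change z • a • u = a • u
    rw [hcomm, show z • u = u from hu]
  obtain ⟨u₂, hu₂, h₂⟩ := IH N.ker hU₂ fun a u hu => by
    change powSum z n (a • u) = 0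
    rw [hsum, show powSum z n u = 0 from hu, smul_zero]
  refine ⟨u₁ + u₂, fun a ha => ?_⟩
  have hN₁ : powSum z n u₁ = n • u₁ := powSum_of_fixed n hu₁
  have hN₂ : powSum z n u₂ = 0 := hu₂
  -- The norm kills `u₂` and multiplies `u₁` by `n`, which is injective on `V`.
  have ha₁ : a • u₁ = u₁ := by
    have h := congrArg (powSum z n) ha
    rw [hsum, powSum_add, hN₁, hN₂, add_zero, smul_comm a n, ← sub_eq_zero, ← nsmul_sub] at h
    exact sub_eq_zero.mp (hn0 h)
  have ha₂ : a • u₂ = u₂ := by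
    rw [smul_add, ha₁, add_right_inj] at ha
    exact ha
  intro w
  have hw₁ := h₁ a ha₁ (powSum z n w) (smul_powSum hzn w)
  have hw₂ := h₂ a ha₂ (n • w - powSum z n w) (by
    change N _ = 0
    rw [map_sub, map_nsmul]
    change n • powSum z n w - powSum z n (powSum z n w) = 0
    rw [powSum_of_fixed n (smul_powSum hzn w), sub_self])
  rw [smul_sub, hw₁, sub_left_inj, smul_comm a n, ← sub_eq_zero, ← nsmul_sub] at hw₂
  exact sub_eq_zero.mp (hn0 hw₂)

/-- If `c` is noncentral of prime order `r`, central modulo a fixed-point-free central subgroup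
`⟨z⟩` of order `r`, then `V` is induced from the fixed space of `c` as a module for the centralizer
of `c`, and a suitable vector is found by combining translates of `x` and `-x`. -/
theorem exists_regular_of_noncentral (hoddA : Odd (Nat.card A)) (hoddV : Odd (Nat.card V))
    {r : ℕ} (hr : r.Prime) (hrV : (Nat.card V).Coprime r) {c z g₀ : A}
    (hz : z ∈ Subgroup.center A) (hzo : orderOf z = r) (hfpf : ∀ y ∈ Subgroup.center A,
      y ≠ 1 → ∀ v : V, y • v = v → v = 0)
    (hcr : c ^ r = 1) (hg₀ : g₀ * c * g₀⁻¹ = c * z)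
    (hc : ∀ g, ∃ t < r, g * c * g⁻¹ = c * z ^ t) {x : V} (hx0 : x ≠ 0) (hcx : c • x = x)
    (hx : ∀ a : A, Commute a c → a • x = x → ∀ w : V, c • w = w → a • w = w) :
    ∃ v : V, ∀ a : A, a • v = v → ∀ w : V, a • w = w := by
  have hzr : z ^ r = 1 := hzo ▸ pow_orderOf_eq_one z
  have hz1 : z ≠ 1 := by
    rintro rfl
    rw [orderOf_one] at hzo
    exact hr.one_lt.ne hzo
  have hzc (g : A) (j : ℕ) : g * z ^ j = z ^ j * g :=
    Subgroup.mem_center_iff.mp (pow_mem hz j) g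
  have hconj (j : ℕ) := conj_pow_eq_mul_pow hz hg₀ j
  have hczr (j : ℕ) : (c * z ^ j) ^ r = 1 := by
    rw [Commute.mul_pow (hzc c j), hcr, ← pow_mul, mul_comm j, pow_mul, hzr, one_pow, one_mul]
  -- The component at 0 alone has a plus sign, so that no element of odd order can carry it to
  -- another component.
  let f : ℕ → V := fun j => if j = 0 then x else -(g₀ ^ j • x)
  have hf0 : f 0 = x := if_pos rfl
  have hf (j : ℕ) : (c * z ^ j) • f j = f j := by
    have h : (c * z ^ j) • g₀ ^ j • x = g₀ ^ j • x := by
      rw [← hconj, ← mul_smul, inv_mul_cancel_right, mul_smul, hcx]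
    by_cases hj : j = 0
    · subst hj
      simpa [f] using hcx
    · simp only [f, if_neg hj, smul_neg, h]
  have hfij {i j : ℕ} (hi : i < r) (hj : j < r) (hij : i ≠ j) :
      powSum (c * z ^ i) r (f j) = 0 := by
    have hy : z ^ ((i : ℤ) - j) ∈ Subgroup.center A := zpow_mem hz _
    -- On the fixed space of `c * z ^ j`, the element `c * z ^ i` acts as the central `z ^ (i - j)`,
    -- which has no nonzero fixed vectors.
    have hact : (c * z ^ i) • f j = z ^ ((i : ℤ) - j) • f j := by
      conv_rhs => rw [← hf j, ← mul_smul, ← Subgroup.mem_center_iff.mp hy]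
      congr 1
      rw [mul_assoc, ← zpow_natCast z j, ← zpow_add, add_sub_cancel, zpow_natCast]
    rw [powSum_congr hy r hact]
    refine powSum_eq_zero ?_ (hfpf _ hy fun h => hij ?_) _
    · rw [← zpow_natCast, ← zpow_mul, mul_comm, zpow_mul, zpow_natCast, hzr, one_zpow]
    · rw [zpow_sub, zpow_natCast, zpow_natCast, mul_inv_eq_one] at h
      exact pow_injOn_Iio_orderOf (by simpa [hzo] using hi) (by simpa [hzo] using hj) h
  let v : V := ∑ j ∈ Finset.range r, f j
  -- This norm is `r` times the projection onto the `i`-th component, so `b` must permute components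
  -- as it permutes the conjugates of `c`.
  have hv {i : ℕ} (hi : i < r) : powSum (c * z ^ i) r v = r • f i := by
    rw [powSum_sum, Finset.sum_eq_single_of_mem i (Finset.mem_range.mpr hi)]
    · exact powSum_of_fixed r (hf i)
    · intro j hj hji
      exact hfij hi (Finset.mem_range.mp hj) hji.symm
  have hr0 {v : V} : r • v = 0 → v = 0 := eq_zero_of_nsmul_eq_zero_of_coprime hrV
  have hrinj {v w : V} (h : r • v = r • w) : v = w := by
    rw [← sub_eq_zero, ← nsmul_sub] at h
    exact sub_eq_zero.mp (hr0 h)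
  refine ⟨v, fun b hb => ?_⟩
  obtain ⟨t, htr, ht⟩ := hc b
  have hbf {i : ℕ} (hi : i < r) (hit : i + t < r) : b • f i = f (i + t) := by
    have h := smul_powSum_conj b (c * z ^ i) r v
    have h' : b * (c * z ^ i) * b⁻¹ = c * z ^ (i + t) := by
      calc b * (c * z ^ i) * b⁻¹ = b * c * (z ^ i * b⁻¹) := by group
        _ = b * c * b⁻¹ * z ^ i := by rw [← hzc]; group
        _ = _ := by rw [ht, mul_assoc, ← pow_add, add_comm]
    rw [hb, h', hv hi, hv hit, smul_comm b r] at h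
    exact hrinj h
  by_cases ht0 : t = 0
  · subst ht0
    have hbc : Commute b c := by
      rw [pow_zero, mul_one, mul_inv_eq_iff_eq_mul] at ht
      exact ht
    have hcz (j : ℕ) : b * (g₀ ^ j * c * (g₀ ^ j)⁻¹) = g₀ ^ j * c * (g₀ ^ j)⁻¹ * b := by
      rw [hconj, ← mul_assoc, hbc.eq, mul_assoc, hzc, mul_assoc]
    have htriv {i : ℕ} (hi : i < r) (w : V) (hw : (c * z ^ i) • w = w) : b • w = w := by
      have h1 : b • g₀ ^ i • x = g₀ ^ i • x := by
        have := hbf hi (by simpa using hi)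
        rw [add_zero] at this
        by_cases hi0 : i = 0
        · subst hi0
          simpa [f] using this
        · simpa [f, hi0] using this
      -- Conjugating by `g₀ ^ i` carries the `i`-th component back to the fixed space of `c`, where
      -- `hx` applies.
      have h2 := hx ((g₀ ^ i)⁻¹ * b * g₀ ^ i) (by
        have := hcz i
        change (g₀ ^ i)⁻¹ * b * g₀ ^ i * c = c * ((g₀ ^ i)⁻¹ * b * g₀ ^ i)
        calc (g₀ ^ i)⁻¹ * b * g₀ ^ i * c
            = (g₀ ^ i)⁻¹ * (b * (g₀ ^ i * c * (g₀ ^ i)⁻¹)) * g₀ ^ i := by group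
          _ = _ := by rw [this]; group)
        (by rw [mul_smul, mul_smul, h1, inv_smul_smul]) ((g₀ ^ i)⁻¹ • w) (by
          conv_rhs => rw [← hw, ← hconj]
          simp [mul_smul])
      rw [mul_smul, mul_smul, smul_inv_smul, inv_smul_eq_iff, smul_inv_smul] at h2
      exact h2
    intro w
    refine hrinj ?_
    rw [← smul_comm b r, ← sum_powSum_eq_nsmul (Subgroup.mem_center_iff.mp hz c) hr hzr
      (hfpf z hz hz1) w, Finset.smul_sum]
    exact Finset.sum_congr rfl fun i hi =>
      htriv (Finset.mem_range.mp hi) _ (smul_powSum (hczr i) w)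
  -- Here `(g₀ ^ t)⁻¹ * b` negates `x`. Having odd order, it is a power of its square, so it also
  -- fixes `x`; then `2 • x = 0`.
  · have h1 : b • x = -(g₀ ^ t • x) := by
      have := hbf hr.pos (by simpa using htr)
      rwa [zero_add, hf0, show f t = -(g₀ ^ t • x) from if_neg ht0] at this
    set h := (g₀ ^ t)⁻¹ * b with hh
    have h2 : h • x = -x := by rw [hh, mul_smul, h1, smul_neg, inv_smul_smul]
    obtain ⟨l, hl⟩ := hoddA
    have h3 : h ^ 2 ∈ MulAction.stabilizer A x := by
      rw [MulAction.mem_stabilizer_iff, pow_two, mul_smul, h2, smul_neg, h2, neg_neg]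
    have h4 : h ∈ MulAction.stabilizer A x := by
      have h5 : h * (h ^ 2) ^ l = 1 := by
        rw [← pow_mul, ← pow_succ', ← hl, pow_card_eq_one']
      rw [eq_inv_of_mul_eq_one_left h5]
      exact inv_mem (pow_mem h3 l)
    rw [MulAction.mem_stabilizer_iff, h2, neg_eq_iff_add_eq_zero, ← two_nsmul] at h4
    exact absurd (eq_zero_of_nsmul_eq_zero_of_coprime hoddV.coprime_two_right h4) hx0

/-- The inductive step for the existence of regular orbits: `A` acts faithfully on `V`, and the
result is known for subgroups of `A` acting on proper subgroups of `V`. -/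
theorem exists_regular_of_faithful [Finite A] [FaithfulSMul A V] [Group.IsNilpotent A]
    (hoddA : Odd (Nat.card A))
    (hoddV : Odd (Nat.card V)) (hcop : (Nat.card V).Coprime (Nat.card A))
    (IH : ∀ (U : AddSubgroup V) (M : Subgroup A), U ≠ ⊤ → (∀ a ∈ M, ∀ u ∈ U, a • u ∈ U) →
      ∃ u ∈ U, ∀ a ∈ M, a • u = u → ∀ w ∈ U, a • w = w) :
    ∃ v : V, ∀ a : A, a • v = v → ∀ w : V, a • w = w := by
  by_cases hfpf : ∀ y ∈ Subgroup.center A, y ≠ 1 → ∀ v : V, y • v = v → v = 0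
  swap
  · push Not at hfpf
    obtain ⟨z, hz, hz1, v₀, hzv₀, hv₀⟩ := hfpf
    refine exists_regular_of_central_fixed hcop (fun U hU hinv => ?_) hz hz1 hv₀ hzv₀
    obtain ⟨u, hu, h⟩ := IH U ⊤ hU fun a _ => hinv a
    exact ⟨u, hu, fun a => h a (Subgroup.mem_top a)⟩
  rcases subsingleton_or_nontrivial V with hV | hV
  · exact ⟨0, fun a _ w => Subsingleton.elim _ _⟩
  obtain ⟨v₁, hv₁⟩ := exists_ne (0 : V)
  by_cases hab : Subgroup.center A = ⊤
  · refine ⟨v₁, fun a ha w => ?_⟩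
    by_contra haw
    exact hv₁ (hfpf a (hab ▸ Subgroup.mem_top a) (by rintro rfl; simp at haw) v₁ ha)
  have hrV {r : ℕ} (hr : r.Prime) {y : A} (hy : y ^ r = 1) (hy1 : y ≠ 1) :
      (Nat.card V).Coprime r := by
    have : Fact r.Prime := ⟨hr⟩
    exact hcop.coprime_dvd_right (orderOf_eq_prime hy hy1 ▸ orderOf_dvd_natCard y)
  -- If `y` were not a power of `x`, all the `y * x ^ j` would be fixed-point-free, and the norm
  -- identity would give `r • v₁ = 0`.
  have hcyc : ∀ r : ℕ, r.Prime → ∀ x ∈ Subgroup.center A, ∀ y ∈ Subgroup.center A,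
      x ^ r = 1 → y ^ r = 1 → x ≠ 1 → y ∈ Subgroup.zpowers x := by
    intro r hr x hx y hy hxr hyr hx1
    by_contra hmem
    have hyx : Commute y x := Subgroup.mem_center_iff.mp hx y
    have h := sum_powSum_eq_nsmul hyx hr hxr (hfpf x hx hx1) v₁
    rw [Finset.sum_eq_zero] at h
    · exact hv₁ (eq_zero_of_nsmul_eq_zero_of_coprime (hrV hr hxr hx1) h.symm)
    · intro j _
      refine powSum_eq_zero ?_ (hfpf _ (mul_mem hy (pow_mem hx j)) fun h1 => hmem ?_) v₁
      · rw [(hyx.pow_right j).mul_pow, hyr, ← pow_mul, mul_comm j, pow_mul, hxr, one_pow, one_mul]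
      · rw [eq_inv_of_mul_eq_one_left h1]
        exact inv_mem (pow_mem (Subgroup.mem_zpowers x) j)
  obtain ⟨r, hr, c, hcZ, hcr, hc⟩ :=
    Group.IsNilpotent.exists_noncentral_order_prime hoddA hab hcyc
  have : Fact r.Prime := ⟨hr⟩
  obtain ⟨g₀, hg₀⟩ : ∃ g, g * c * g⁻¹ * c⁻¹ ≠ 1 := by
    by_contra! h
    refine hcZ (Subgroup.mem_center_iff.mpr fun g => ?_)
    have := h g
    rwa [mul_inv_eq_one, mul_inv_eq_iff_eq_mul] at this
  set z := g₀ * c * g₀⁻¹ * c⁻¹ with hzdef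
  obtain ⟨hz, hzr⟩ := hc g₀
  rw [← hzdef] at hz hzr
  have hzo : orderOf z = r := orderOf_eq_prime hzr hg₀
  have hconj : g₀ * c * g₀⁻¹ = c * z := by
    rw [Subgroup.mem_center_iff.mp hz c, hzdef, inv_mul_cancel_right]
  have hconj' : ∀ g, ∃ t < r, g * c * g⁻¹ = c * z ^ t := by
    intro g
    obtain ⟨hgZ, hgr⟩ := hc g
    have := hcyc r hr z hz _ hgZ hzr hgr hg₀
    classical
    rw [mem_zpowers_iff_mem_range_orderOf, hzo, Finset.mem_image] at this
    obtain ⟨t, ht, htg⟩ := this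
    refine ⟨t, Finset.mem_range.mp ht, ?_⟩
    rw [htg, Subgroup.mem_center_iff.mp hgZ c, inv_mul_cancel_right]
  let U : AddSubgroup V :=
    { carrier := {v | c • v = v}
      zero_mem' := smul_zero c
      add_mem' := fun {a b} ha hb => by
        rw [Set.mem_ofPred_eq] at *
        rw [smul_add, ha, hb]
      neg_mem' := fun {a} ha => by
        rw [Set.mem_ofPred_eq] at *
        rw [smul_neg, ha] }
  have hU : U ≠ ⊤ := by
    intro h
    refine hcZ ?_
    have : c = 1 := FaithfulSMul.eq_of_smul_eq_smul (α := V) fun v => by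
      rw [one_smul]
      exact (h ▸ AddSubgroup.mem_top v : v ∈ U)
    rw [this]
    exact one_mem _
  obtain ⟨x, hxU, hx⟩ := IH U (Subgroup.centralizer {c}) hU fun a ha u hu => by
    change c • a • u = a • u
    rw [← mul_smul, ← Subgroup.mem_centralizer_singleton_iff.mp ha, mul_smul,
      show c • u = u from hu]
  -- If `x = 0`, then `z` is trivial on the fixed space of `c`, which is thus zero. The conjugates
  -- `c * z ^ j` then have zero norms, contradicting the norm identity.
  have hx0 : x ≠ 0 := by
    rintro rfl
    have hcz : Commute c z := Subgroup.mem_center_iff.mp hz c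
    have hU0 : ∀ w : V, c • w = w → w = 0 := fun w hw =>
      hfpf z hz hg₀ w (hx z (Subgroup.mem_centralizer_singleton_iff.mpr hcz.symm.eq)
        (smul_zero z) w hw)
    have h := sum_powSum_eq_nsmul hcz hr hzr (hfpf z hz hg₀) v₁
    rw [Finset.sum_eq_zero] at h
    · exact hv₁ (eq_zero_of_nsmul_eq_zero_of_coprime (hrV hr hzr hg₀) h.symm)
    · intro j _
      have hfix := smul_powSum (a := c * z ^ j) (n := r) (by
        rw [(hcz.pow_right j).mul_pow, hcr, ← pow_mul, mul_comm j, pow_mul, hzr, one_pow, one_mul])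
        v₁
      rw [← conj_pow_eq_mul_pow hz hconj] at hfix ⊢
      rw [mul_smul, mul_smul, ← eq_inv_smul_iff] at hfix
      exact (smul_eq_zero_iff_eq _).mp (hU0 _ hfix)
  exact exists_regular_of_noncentral hoddA hoddV hr (hrV hr hzr hg₀) hz hzo hfpf hcr hconj hconj'
    hx0 hxU fun a ha hax w hw =>
      hx a (Subgroup.mem_centralizer_singleton_iff.mpr ha.eq) hax w hw

end RegularOrbit

/-- The action on an invariant additive subgroup. -/
@[reducible]
def AddSubgroup.distribMulActionOfInvariant {M V : Type*} [Group M] [AddCommGroup V]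
    [DistribMulAction M V] (U : AddSubgroup V) (h : ∀ m : M, ∀ u ∈ U, m • u ∈ U) :
    DistribMulAction M U where
  smul m u := ⟨m • (u : V), h m u u.2⟩
  one_smul u := Subtype.ext (one_smul M (u : V))
  mul_smul a b u := Subtype.ext (mul_smul a b (u : V))
  smul_zero a := Subtype.ext (smul_zero a)
  smul_add a u v := Subtype.ext (smul_add a (u : V) v)

universe u

section RegularOrbit

/-- Replacing `A` by its image in the permutations of `V` gives faithfulness. Subgroups of that
image need not stay faithful on smaller modules, so the induction covers arbitrary actions. -/
theorem exists_regular_of_card_eq (n : ℕ) (V A : Type u) [AddCommGroup V] [Finite V]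
    (hn : Nat.card V = n) [Group A] [Finite A] [Group.IsNilpotent A] [DistribMulAction A V]
    (hoddV : Odd (Nat.card V)) (hoddA : Odd (Nat.card A))
    (hcop : (Nat.card V).Coprime (Nat.card A)) :
    ∃ v : V, ∀ a : A, a • v = v → ∀ w : V, a • w = w := by
  induction n using Nat.strong_induction_on generalizing V A with
  | _ n ih =>
    let ρ := MulAction.toPermHom A V
    have hdvd : Nat.card ρ.range ∣ Nat.card A := Subgroup.card_range_dvd ρ
    let _ : DistribMulAction ρ.range V :=
      { smul_zero := by
          rintro ⟨_, a, rfl⟩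
          exact smul_zero a
        smul_add := by
          rintro ⟨_, a, rfl⟩
          exact smul_add a }
    have : Group.IsNilpotent ρ.range := Group.nilpotent_of_surjective _ ρ.rangeRestrict_surjective
    obtain ⟨v, hv⟩ := exists_regular_of_faithful (A := ρ.range) (V := V)
      (hoddA.of_dvd_nat hdvd) hoddV (hcop.coprime_dvd_right hdvd) fun U M hU hM => by
        let _ : DistribMulAction M U :=
          U.distribMulActionOfInvariant fun m : M => hM m m.2
        have hUdvd : Nat.card U ∣ Nat.card V := AddSubgroup.card_addSubgroup_dvd_card U
        have hMdvd : Nat.card M ∣ Nat.card A := (Subgroup.card_subgroup_dvd_card M).trans hdvd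
        have hlt : Nat.card U < n := by
          rw [← hn]
          refine lt_of_le_of_ne (Nat.le_of_dvd Nat.card_pos hUdvd) fun h => hU ?_
          exact AddSubgroup.eq_top_of_card_eq U h
        obtain ⟨u, hu⟩ := ih (Nat.card U) hlt U M rfl (hoddV.of_dvd_nat hUdvd)
          (hoddA.of_dvd_nat hMdvd)
          ((hcop.coprime_dvd_left hUdvd).coprime_dvd_right hMdvd)
        exact ⟨u, u.2, fun a ha hau w hw => congrArg Subtype.val
          (hu ⟨a, ha⟩ (Subtype.ext hau) ⟨w, hw⟩)⟩
    exact ⟨v, fun a => hv ⟨ρ a, a, rfl⟩⟩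

/-- A nilpotent group of odd order acting coprimely on an abelian group of odd order has an orbit
on which it acts as regularly as its kernel permits. -/
theorem exists_regular {V M : Type u} [AddCommGroup V] [Finite V] [Group M] [Finite M]
    [Group.IsNilpotent M] [DistribMulAction M V] (hoddV : Odd (Nat.card V))
    (hoddM : Odd (Nat.card M)) (hcop : (Nat.card V).Coprime (Nat.card M)) :
    ∃ v : V, ∀ m : M, m • v = v → ∀ w : V, m • w = w :=
  exists_regular_of_card_eq _ V M rfl hoddV hoddM hcop

end RegularOrbit

/-! ### Hall subgroups and primary decomposition -/

/-- A nilpotent group has a Hall `q'`-subgroup containing all Sylow subgroups for the other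
primes. -/
theorem Group.IsNilpotent.exists_hall {A : Type*} [Group A] [Finite A] [Group.IsNilpotent A]
    (q : ℕ) [Fact q.Prime] :
    ∃ T : Subgroup A, ¬ q ∣ Nat.card T ∧
      ∀ p : ℕ, p.Prime → p ≠ q → ∀ a : A, (∃ k, a ^ p ^ k = 1) → a ∈ T := by
  obtain ⟨Q⟩ : Nonempty (Sylow q A) := inferInstance
  obtain ⟨T, hT⟩ := Subgroup.exists_right_complement'_of_coprime (N := (Q : Subgroup A))
    Q.card_coprime_index
  have hcard : Nat.card Q * Nat.card T = Nat.card A := hT.card_mul_card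
  refine ⟨T, ?_, fun p hp hpq a ⟨k, hk⟩ => ?_⟩
  · rw [← hT.symm.index_eq_card]
    exact Q.not_dvd_index
  · have : Fact p.Prime := ⟨hp⟩
    obtain ⟨S⟩ : Nonempty (Sylow p T) := inferInstance
    obtain ⟨m, hm⟩ := IsPGroup.iff_card.mp Q.isPGroup'
    -- `|A| = |Q| |T|` with `|Q|` prime to `p`, so `S` is already the unique Sylow `p`-subgroup of
    -- `A`.
    have hS : Nat.card ((S : Subgroup T).map T.subtype) =
        p ^ (Nat.card A).factorization p := by
      rw [Subgroup.card_map_of_injective T.subtype_injective, S.card_eq_multiplicity, ← hcard,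
        Nat.factorization_mul Nat.card_pos.ne' Nat.card_pos.ne', Finsupp.add_apply,
        hm, Nat.factorization_eq_zero_of_not_dvd (n := q ^ m), zero_add]
      exact fun h => hpq ((Nat.prime_dvd_prime_iff_eq hp Fact.out).mp (hp.dvd_of_dvd_pow h))
    have ha : IsPGroup p (Subgroup.zpowers a) := by
      refine IsPGroup.of_card_dvd_pow (n := k) ?_
      rw [Nat.card_zpowers]
      exact orderOf_dvd_of_pow_eq_one hk
    obtain ⟨P, hP⟩ := ha.exists_le_sylow
    rw [P.eq_of_isNilpotent (Sylow.ofCard _ hS), Sylow.coe_ofCard] at hP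
    obtain ⟨t, -, ht⟩ := hP (Subgroup.mem_zpowers a)
    exact ht ▸ t.2

section Primary

variable {W : Type u} [AddCommGroup W]

/-- The elements killed by the highest power of `q` dividing the order of the group. -/
noncomputable def primaryPart (W : Type*) [AddCommGroup W] (q : ℕ) : AddSubgroup W :=
  (nsmulAddMonoidHom (q ^ (Nat.card W).factorization q) : W →+ W).ker

theorem mem_primaryPart {q : ℕ} {w : W} :
    w ∈ primaryPart W q ↔ q ^ (Nat.card W).factorization q • w = 0 := Iff.rfl

theorem ordCompl_nsmul_mem_primaryPart (q : ℕ) (w : W) :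
    (Nat.card W / q ^ (Nat.card W).factorization q) • w ∈ primaryPart W q := by
  rw [mem_primaryPart, ← mul_nsmul', Nat.ordProj_mul_ordCompl_eq_self, card_nsmul_eq_zero']

theorem coprime_card_primaryPart [Finite W] {q m : ℕ} (hq : q.Prime) (hm : ¬ q ∣ m) :
    (Nat.card (primaryPart W q)).Coprime m := by
  refine Nat.coprime_of_dvd fun l hl hlW hlm => hm ?_
  have : Fact l.Prime := ⟨hl⟩
  obtain ⟨x, hx⟩ := exists_prime_addOrderOf_dvd_card' l hlW
  have h : l ∣ q ^ (Nat.card W).factorization q := by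
    rw [← hx]
    exact addOrderOf_dvd_of_nsmul_eq_zero (Subtype.ext (mem_primaryPart.mp x.2))
  rwa [← (Nat.prime_dvd_prime_iff_eq hl hq).mp (hl.dvd_of_dvd_pow h)]

theorem eq_zero_of_mem_primaryPart [Finite W] {q : ℕ} (hq : q.Prime) {w : W}
    (hw : w ∈ primaryPart W q) {n : ℕ} (hn : n • w = 0) (hqn : ¬ q ∣ n) : w = 0 := by
  have h1 := addOrderOf_dvd_of_nsmul_eq_zero (mem_primaryPart.mp hw)
  have h2 := addOrderOf_dvd_of_nsmul_eq_zero hn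
  rw [← AddMonoid.addOrderOf_eq_one_iff]
  exact Nat.eq_one_of_dvd_coprimes (((hq.coprime_iff_not_dvd).mpr hqn).pow_left _) h1 h2

/-- Primary decomposition of a regular orbit: the vector `w` detects, for every `p`, how `p`-elements
act on the part of `W` of order prime to `p`. -/
theorem exists_regular_primary [Finite W] (hoddW : Odd (Nat.card W))
    (A : Type u) [Group A] [Finite A] [Group.IsNilpotent A] [DistribMulAction A W]
    (hoddA : Odd (Nat.card A)) :
    ∃ w : W, ∀ p : ℕ, p.Prime → ∀ a : A, (∃ k, a ^ p ^ k = 1) →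
      (∃ k, p ^ k • (a • w - w) = 0) → ∀ u : W, ∃ k, p ^ k • (a • u - u) = 0 := by
  have hinv (q : ℕ) (a : A) (u : W) (hu : u ∈ primaryPart W q) : a • u ∈ primaryPart W q := by
    rw [mem_primaryPart] at *
    rw [← smul_comm, hu, smul_zero]
  -- Stated for every `q`, with the dummy value 0 off the primes, so that `choose` yields a function
  -- on ℕ.
  have key (q : ℕ) : ∃ x ∈ primaryPart W q, q.Prime → ∀ p : ℕ, p.Prime → p ≠ q → ∀ a : A,
      (∃ k, a ^ p ^ k = 1) → a • x = x → ∀ u ∈ primaryPart W q, a • u = u := by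
    by_cases hq : q.Prime
    swap
    · exact ⟨0, zero_mem _, fun h => absurd h hq⟩
    have : Fact q.Prime := ⟨hq⟩
    obtain ⟨T, hT, hTmem⟩ := Group.IsNilpotent.exists_hall (A := A) q
    let _ : DistribMulAction T (primaryPart W q) :=
      (primaryPart W q).distribMulActionOfInvariant fun t : T => hinv q t
    obtain ⟨x, hx⟩ := exists_regular (V := primaryPart W q) (M := T)
      (hoddW.of_dvd_nat (AddSubgroup.card_addSubgroup_dvd_card _))
      (hoddA.of_dvd_nat (Subgroup.card_subgroup_dvd_card T)) (coprime_card_primaryPart hq hT)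
    exact ⟨x, x.2, fun _ p hp hpq a ha hax u hu => congrArg Subtype.val
      (hx ⟨a, hTmem p hp hpq a ha⟩ (Subtype.ext hax) ⟨u, hu⟩)⟩
  choose x hxmem hx using key
  set N := Nat.card W with hN
  have hN0 : N ≠ 0 := Nat.card_pos.ne'
  refine ⟨∑ q ∈ N.primeFactors, x q, fun p hp a ha ⟨k, hk⟩ u => ?_⟩
  have htriv (q : ℕ) (hq : q ∈ N.primeFactors) (hpq : p ≠ q) :
      ∀ u ∈ primaryPart W q, a • u = u := by
    have hqp := Nat.prime_of_mem_primeFactors hq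
    refine hx q hqp p hp hpq a ha (sub_eq_zero.mp ?_)
    -- The multiplier is prime to `q`; its first factor kills every other primary component of `w`.
    refine eq_zero_of_mem_primaryPart hqp (sub_mem (hinv q a _ (hxmem q)) (hxmem q))
      (n := (N / q ^ N.factorization q) * p ^ k) ?_ ?_
    · have h1 := congrArg ((N / q ^ N.factorization q) • ·) hk
      simp only [smul_zero, smul_smul, Finset.smul_sum, ← Finset.sum_sub_distrib] at h1
      rw [Finset.sum_eq_single_of_mem q hq] at h1
      · exact h1
      · intro l hl hlq
        have hlp := Nat.prime_of_mem_primeFactors hl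
        have hdvd : l ^ N.factorization l ∣ N / q ^ N.factorization q := by
          refine Nat.Coprime.dvd_of_dvd_mul_left (m := q ^ N.factorization q) ?_ ?_
          · exact Nat.Coprime.pow _ _ ((Nat.coprime_primes hlp hqp).mpr hlq)
          · rw [Nat.ordProj_mul_ordCompl_eq_self]
            exact Nat.ordProj_dvd N l
        obtain ⟨c, hc⟩ := hdvd
        have := mem_primaryPart.mp (sub_mem (hinv l a _ (hxmem l)) (hxmem l))
        rw [hc, mul_assoc, mul_nsmul, this, smul_zero]
    · rw [hqp.dvd_mul, not_or]
      exact ⟨Nat.not_dvd_ordCompl hqp hN0, fun h => hpq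
        ((Nat.prime_dvd_prime_iff_eq hqp hp).mp (hqp.dvd_of_dvd_pow h)).symm⟩
  refine ⟨N.factorization p, ?_⟩
  -- No prime divides the order: `p` was stripped by the multiplier, and for `q ≠ p` the `q`-part of
  -- `u` is fixed by `a`.
  rw [← AddMonoid.addOrderOf_eq_one_iff, Nat.eq_one_iff_not_exists_prime_dvd]
  intro q hq hqdvd
  have hordN : addOrderOf (p ^ N.factorization p • (a • u - u)) ∣ N := addOrderOf_dvd_natCard _
  by_cases hpq : p = q
  · subst hpq
    refine Nat.not_dvd_ordCompl hp hN0 (hqdvd.trans (addOrderOf_dvd_of_nsmul_eq_zero ?_))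
    exact_mod_cast (mul_nsmul (a • u - u) _ _).symm.trans (by
      rw [Nat.ordProj_mul_ordCompl_eq_self]; exact card_nsmul_eq_zero')
  · refine Nat.not_dvd_ordCompl hq hN0 (hqdvd.trans (addOrderOf_dvd_of_nsmul_eq_zero ?_))
    have h1 := htriv q (Nat.mem_primeFactors.mpr ⟨hq, hqdvd.trans hordN, hN0⟩) hpq _
      (ordCompl_nsmul_mem_primaryPart q u)
    rw [smul_comm, ← sub_eq_zero, ← nsmul_sub] at h1
    rw [smul_comm, h1, smul_zero]

end Primary

/-! ### Coprime automorphisms of nilpotent groups -/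

/-- Maximal subgroups of a finite nilpotent group are normal and contain the commutator subgroup. -/
theorem Group.IsNilpotent.eq_top_of_sup_commutator_eq_top {Q : Type*} [Group Q] [Finite Q]
    [Group.IsNilpotent Q] {D : Subgroup Q} (h : D ⊔ commutator Q = ⊤) : D = ⊤ := by
  rcases eq_top_or_exists_le_coatom D with hD | ⟨M, hM, hDM⟩
  · exact hD
  have hMn : M.Normal :=
    (Group.isNilpotent_of_finite_tfae (G := Q).out 0 2 rfl rfl).mp inferInstance M hM
  have : Nontrivial (Q ⧸ M) := QuotientGroup.nontrivial_iff.mpr hM.1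
  have hlt := IsSolvable.commutator_lt_top_of_nontrivial (Q ⧸ M)
  have hsurj := QuotientGroup.mk'_surjective M
  have hcomap : (commutator (Q ⧸ M)).comap (QuotientGroup.mk' M) = M := by
    have hle : M ≤ (commutator (Q ⧸ M)).comap (QuotientGroup.mk' M) := by
      intro x hx
      rw [Subgroup.mem_comap, QuotientGroup.mk'_apply, (QuotientGroup.eq_one_iff x).mpr hx]
      exact one_mem _
    refine (hM.le_iff.mp hle).resolve_left fun htop => hlt.ne ?_
    rw [← Subgroup.map_comap_eq_self_of_surjective hsurj (commutator (Q ⧸ M)), htop,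
      Subgroup.map_top_of_surjective _ hsurj]
  have hcomm : commutator Q ≤ M := by
    rw [← hcomap, ← Subgroup.map_le_iff_le_comap, commutator_def, Subgroup.map_commutator,
      commutator_def]
    exact Subgroup.commutator_mono le_top le_top
  exact absurd (top_le_iff.mp (h ▸ sup_le hDM hcomm)) hM.1

/-- An automorphism of `p`-power order of a nilpotent `p'`-group is trivial as soon as it is trivial
on the abelianization. -/
theorem MulAut.apply_eq_self_of_abelianization {Q : Type*} [Group Q] [Finite Q]
    [Group.IsNilpotent Q] {p : ℕ} [Fact p.Prime] (hp : ¬ p ∣ Nat.card Q) {α : MulAut Q}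
    (hα : ∃ k, α ^ p ^ k = 1) (h : ∀ y, α y * y⁻¹ ∈ commutator Q) (y : Q) : α y = y := by
  let K : Subgroup (MulAut Q) :=
    { carrier := {β | ∀ x, β x * x⁻¹ ∈ commutator Q}
      one_mem' := fun x => by simp [one_mem]
      mul_mem' := fun {a b} ha hb x => by
        have := mul_mem (ha (b x)) (hb x)
        simpa [mul_assoc] using this
      inv_mem' := fun {a} ha x => by
        have := inv_mem (ha (a⁻¹ x))
        simpa using this }
  have hK : Subgroup.zpowers α ≤ K := by
    rw [Subgroup.zpowers_le]
    exact h
  have hpgroup : IsPGroup p (Subgroup.zpowers α) := by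
    obtain ⟨k, hk⟩ := hα
    refine IsPGroup.of_card_dvd_pow (n := k) ?_
    rw [Nat.card_zpowers]
    exact orderOf_dvd_of_pow_eq_one hk
  let D : Subgroup Q :=
    { carrier := {x | α x = x}
      one_mem' := map_one α
      mul_mem' := fun {a b} ha hb => by
        rw [Set.mem_ofPred_eq] at *
        rw [map_mul, ha, hb]
      inv_mem' := fun {a} ha => by
        rw [Set.mem_ofPred_eq] at *
        rw [map_inv, ha] }
  have hD : D = ⊤ := by
    refine Group.IsNilpotent.eq_top_of_sup_commutator_eq_top (top_le_iff.mp fun y _ => ?_)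
    -- A `p`-group acting on a coset of the commutator subgroup, of size prime to `p`, has a fixed
    -- point there.
    let _ : MulAction (Subgroup.zpowers α) {x : Q // x * y⁻¹ ∈ commutator Q} :=
      { smul := fun β x => ⟨β.1 x, by
          have := mul_mem (hK β.2 x.1) x.2
          rwa [mul_assoc, inv_mul_cancel_left] at this⟩
        one_smul := fun x => rfl
        mul_smul := fun β γ x => rfl }
    have hcard : Nat.card {x : Q // x * y⁻¹ ∈ commutator Q} = Nat.card (commutator Q) :=
      Nat.card_congr ((Equiv.mulRight y⁻¹).subtypeEquiv fun _ => Iff.rfl)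
    obtain ⟨⟨x, hx⟩, hfix⟩ := hpgroup.nonempty_fixed_point_of_prime_not_dvd_card
      {x : Q // x * y⁻¹ ∈ commutator Q} (by
        rw [hcard]
        exact fun hdvd => hp (hdvd.trans (Subgroup.card_subgroup_dvd_card _)))
    have hxD : x ∈ D := congrArg Subtype.val (hfix ⟨α, Subgroup.mem_zpowers α⟩)
    have hy : y = (x * y⁻¹)⁻¹ * x := by group
    rw [hy]
    exact mul_mem ((le_sup_right : commutator Q ≤ D ⊔ commutator Q) (inv_mem hx))
      ((le_sup_left : D ≤ D ⊔ commutator Q) hxD)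
  exact (hD ▸ Subgroup.mem_top y : y ∈ D)

/-- `N ⧸ S` has order prime to `p`, so `p`-power torsion disappears in its abelianization and the
induced automorphism is trivial. -/
theorem MulAut.mul_inv_mem_sylow_of_abelianization {N : Type*} [Group N] [Finite N]
    [Group.IsNilpotent N] {p : ℕ} [Fact p.Prime] (S : Sylow p N) {α : MulAut N}
    (hα : ∃ k, α ^ p ^ k = 1)
    (h : ∀ y, ∃ k, Abelianization.of (α y * y⁻¹) ^ p ^ k = 1) (y : N) : α y * y⁻¹ ∈ S := by
  have hchar : (S : Subgroup N).Characteristic := S.characteristic_of_normal inferInstance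
  let β : MulAut (N ⧸ (S : Subgroup N)) :=
    QuotientGroup.congr _ _ α (Subgroup.characteristic_iff_map_eq.mp hchar α)
  have hβ (x : N) : β (x : N ⧸ (S : Subgroup N)) = (α x : N) := rfl
  have hpow (n : ℕ) (x : N) : (β ^ n) (x : N ⧸ (S : Subgroup N)) = ((α ^ n) x : N) := by
    induction n generalizing x with
    | zero => rfl
    | succ n ih => rw [pow_succ, pow_succ, MulAut.mul_apply, hβ, ih, MulAut.mul_apply]
  have hp : ¬ p ∣ Nat.card (N ⧸ (S : Subgroup N)) := S.not_dvd_index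
  have hfix := MulAut.apply_eq_self_of_abelianization hp (α := β) (by
    obtain ⟨k, hk⟩ := hα
    refine ⟨k, MulEquiv.ext fun x => ?_⟩
    obtain ⟨x, rfl⟩ := QuotientGroup.mk_surjective x
    rw [hpow, hk]
    rfl) (fun x => by
    obtain ⟨x, rfl⟩ := QuotientGroup.mk_surjective x
    obtain ⟨k, hk⟩ := h x
    rw [hβ, ← QuotientGroup.mk_inv, ← QuotientGroup.mk_mul]
    set t := α x * x⁻¹
    have h1 : t ^ p ^ k ∈ commutator N := by
      rw [← map_pow] at hk
      exact (QuotientGroup.eq_one_iff _).mp hk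
    have h2 : (t : N ⧸ (S : Subgroup N)) ^ p ^ k ∈ commutator (N ⧸ (S : Subgroup N)) := by
      have h3 := Subgroup.mem_map_of_mem (QuotientGroup.mk' (S : Subgroup N)) h1
      rw [commutator_def, Subgroup.map_commutator] at h3
      exact Subgroup.commutator_mono le_top le_top h3
    have hcop : (p ^ k).Coprime (orderOf (t : N ⧸ (S : Subgroup N))) :=
      (((Fact.out : p.Prime).coprime_iff_not_dvd).mpr
        fun hdvd => hp (hdvd.trans (orderOf_dvd_natCard _))).pow_left k
    obtain ⟨m, hm⟩ := exists_pow_eq_self_of_coprime hcop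
    rw [← hm]
    exact pow_mem h2 m) (y : N ⧸ (S : Subgroup N))
  rw [hβ, QuotientGroup.eq_iff_div_mem, div_eq_mul_inv] at hfix
  exact hfix

/-! ### The p-core -/

section PCore

variable {G : Type*} [Group G] {p : ℕ}

theorem pCore_le (P : Sylow p G) : pCore p G ≤ P := iInf_le _ P

theorem conjSubgroup_sylow (P : Sylow p G) (g : G) :
    conjSubgroup (P : Subgroup G) g = ((g⁻¹ • P : Sylow p G) : Subgroup G) := rfl

theorem pCore_le_inf_conjSubgroup (P : Sylow p G) (g : G) :
    pCore p G ≤ (P : Subgroup G) ⊓ conjSubgroup (P : Subgroup G) g :=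
  le_inf (pCore_le P) (conjSubgroup_sylow P g ▸ pCore_le _)

instance pCore_normal : (pCore p G).Normal where
  conj_mem x hx g := by
    rw [pCore, Subgroup.mem_iInf] at *
    intro Q
    obtain ⟨y, hy, hyx⟩ := (mem_conjSubgroup _ _ _).mp (conjSubgroup_sylow Q g ▸ hx (g⁻¹ • Q))
    rw [← hyx]
    simpa [mul_assoc] using hy

theorem IsPGroup.le_pCore {H : Subgroup G} [H.Normal] (hH : IsPGroup p H) : H ≤ pCore p G :=
  le_iInf fun Q => hH.le_sylow_of_normal Q

/-- The image of `P` in the nilpotent quotient is normal, so `PN` is normal and the Frattini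
argument applies to it. -/
theorem Sylow.normalizer_sup_eq_top_of_isNilpotent_quotient [Finite G] [Fact p.Prime]
    (P : Sylow p G) {N : Subgroup G} [N.Normal] [Group.IsNilpotent (G ⧸ N)] :
    Subgroup.normalizer (P : Set G) ⊔ N = ⊤ := by
  have hn : ((P : Subgroup G).map (QuotientGroup.mk' N)).Normal := by
    rw [← P.coe_mapSurjective (QuotientGroup.mk'_surjective N)]
    infer_instance
  have hcomap : ((P : Subgroup G).map (QuotientGroup.mk' N)).comap (QuotientGroup.mk' N) =
      (P : Subgroup G) ⊔ N := by
    rw [Subgroup.comap_map_eq, QuotientGroup.ker_mk']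
  have hPN : ((P : Subgroup G) ⊔ N).Normal := hcomap ▸ hn.comap _
  have h := P.normalizer_sup_eq_top' (N := (P : Subgroup G) ⊔ N) le_sup_left
  have hle : (P : Subgroup G) ≤ Subgroup.normalizer (P : Set G) :=
    Subgroup.le_normalizer (H := (P : Subgroup G))
  rwa [← sup_assoc, sup_of_le_left hle] at h

/-- If `G ⧸ N` is nilpotent, the elements of a Sylow `p`-subgroup that centralize `N` modulo
`O_p(G)` lie in `O_p(G)`. -/
theorem Sylow.mem_pCore_of_commutator_mem [Finite G] [Fact p.Prime] (P : Sylow p G)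
    {N : Subgroup G} [N.Normal] [Group.IsNilpotent (G ⧸ N)] {u : G} (hu : u ∈ P)
    (h : ∀ y ∈ N, u * y * u⁻¹ * y⁻¹ ∈ pCore p G) : u ∈ pCore p G := by
  have hNmap : (N.map (QuotientGroup.mk' (pCore p G))).Normal :=
    Subgroup.Normal.map inferInstance _ (QuotientGroup.mk'_surjective _)
  let K : Subgroup G := (Subgroup.centralizer
    (N.map (QuotientGroup.mk' (pCore p G)) : Set (G ⧸ pCore p G))).comap
      (QuotientGroup.mk' (pCore p G))
  have hK (g : G) : g ∈ K ↔ ∀ y ∈ N, g * y * g⁻¹ * y⁻¹ ∈ pCore p G := by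
    rw [Subgroup.mem_comap, Subgroup.mem_centralizer_iff]
    constructor
    · intro hg y hy
      have := hg (y : G ⧸ pCore p G) ⟨y, hy, rfl⟩
      rw [QuotientGroup.mk'_apply] at this
      rw [← QuotientGroup.eq_one_iff]
      simp only [QuotientGroup.mk_mul, QuotientGroup.mk_inv]
      rw [← this]
      simp
    · rintro hg _ ⟨y, hy, rfl⟩
      have := (QuotientGroup.eq_one_iff _).mpr (hg y hy)
      simp only [QuotientGroup.mk_mul, QuotientGroup.mk_inv] at this
      rw [mul_inv_eq_one, mul_inv_eq_iff_eq_mul] at this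
      exact this.symm
  have hKn : K.Normal := Subgroup.Normal.comap inferInstance _
  have hR : ((P : Subgroup G) ⊓ K).Normal := by
    refine ⟨fun r hr g => ?_⟩
    have hg : g ∈ ((Subgroup.normalizer (P : Set G) ⊔ N : Subgroup G) : Set G) := by
      rw [P.normalizer_sup_eq_top_of_isNilpotent_quotient]
      trivial
    rw [Subgroup.mul_normal] at hg
    obtain ⟨a, ha, f, hf, rfl⟩ := hg
    refine ⟨?_, hKn.conj_mem r hr.2 _⟩
    -- Conjugating by `f ∈ N` changes `r` only by an element of O_p(G), which lies in `P`.
    have h1 : f * r * f⁻¹ ∈ P := by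
      have h2 := pCore_le P (inv_mem ((hK r).mp hr.2 f hf))
      have h3 := mul_mem h2 hr.1
      have h4 : (r * f * r⁻¹ * f⁻¹)⁻¹ * r = f * r * f⁻¹ := by group
      rwa [h4] at h3
    have h5 : a * f * r * (a * f)⁻¹ = a * (f * r * f⁻¹) * a⁻¹ := by group
    change a * f * r * (a * f)⁻¹ ∈ (P : Subgroup G)
    rw [h5]
    exact (Subgroup.mem_normalizer_iff.mp ha _).mp h1
  exact (P.isPGroup'.to_inf_left (K := K)).le_pCore ⟨hu, (hK u).mpr h⟩

end PCore

/-! ### Conjugation on the abelianization of N -/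

section Conjugation

variable {G : Type*} [Group G] (N : Subgroup G) [N.Normal]

/-- The conjugation action of a group on the abelianization of a normal subgroup. -/
def conjAbelianization : G →* MulAut (Abelianization N) where
  toFun g := (MulAut.conjNormal g : MulAut N).abelianizationCongr
  map_one' := by
    ext x
    induction x using QuotientGroup.induction_on with
    | H x => exact congrArg Abelianization.of (by simp)
  map_mul' a b := by
    ext x
    induction x using QuotientGroup.induction_on with
    | H x => exact congrArg Abelianization.of (by simp)

theorem conjAbelianization_of (g : G) (x : N) :
    conjAbelianization N g (Abelianization.of x) = Abelianization.of (MulAut.conjNormal g x) :=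
  rfl

theorem conjAbelianization_eq_one {g : G} (hg : g ∈ N) : conjAbelianization N g = 1 := by
  ext x
  induction x using QuotientGroup.induction_on with
  | H x =>
    have : (MulAut.conjNormal g x : N) = ⟨g, hg⟩ * x * ⟨g, hg⟩⁻¹ := Subtype.ext (by simp)
    change Abelianization.of (MulAut.conjNormal g x : N) = Abelianization.of x
    rw [this, map_mul, map_mul, map_inv, mul_comm, inv_mul_cancel_left]

/-- The induced action on the abelianization, written additively. -/
@[reducible]
def additiveAction {W : Type*} [CommGroup W] (A : Subgroup (MulAut W)) :
    DistribMulAction A (Additive W) where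
  smul a w := Additive.ofMul (a.1 w.toMul)
  one_smul _ := rfl
  mul_smul _ _ _ := rfl
  smul_zero a := congrArg Additive.ofMul (map_one a.1)
  smul_add a v w := congrArg Additive.ofMul (map_mul a.1 v.toMul w.toMul)

/-- A suitable element of `N` detects how elements of prime power order act on `N` modulo
commutators. -/
theorem exists_regular_conj [Finite G] [Group.IsNilpotent (G ⧸ N)] (hodd : Odd (Nat.card G)) :
    ∃ x : N, ∀ p : ℕ, p.Prime → ∀ u : G, (∃ k, u ^ p ^ k = 1) →
      (∃ k, Abelianization.of (MulAut.conjNormal u x * x⁻¹) ^ p ^ k = 1) →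
      ∀ y : N, ∃ k, Abelianization.of (MulAut.conjNormal u y * y⁻¹) ^ p ^ k = 1 := by
  let φ := conjAbelianization N
  let _ := additiveAction φ.range
  have hnil : Group.IsNilpotent φ.range := by
    let f : G ⧸ N →* φ.range := QuotientGroup.lift N φ.rangeRestrict fun g hg =>
      Subtype.ext (conjAbelianization_eq_one N hg)
    refine Group.nilpotent_of_surjective f fun a => ?_
    obtain ⟨g, rfl⟩ := φ.rangeRestrict_surjective a
    exact ⟨g, rfl⟩
  have : Finite (Additive (Abelianization N)) :=
    inferInstanceAs (Finite (Abelianization N))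
  obtain ⟨w, hw⟩ := exists_regular_primary (W := Additive (Abelianization N))
    (hodd.of_dvd_nat ((Subgroup.card_quotient_dvd_card _).trans
      (Subgroup.card_subgroup_dvd_card N))) φ.range
    (hodd.of_dvd_nat (Subgroup.card_range_dvd φ))
  obtain ⟨x, hx⟩ := QuotientGroup.mk_surjective w.toMul
  have htr (u : G) (y : N) (n : ℕ) :
      n • ((⟨φ u, u, rfl⟩ : φ.range) • Additive.ofMul (Abelianization.of y) -
        Additive.ofMul (Abelianization.of y)) =
      Additive.ofMul (Abelianization.of (MulAut.conjNormal u y * y⁻¹) ^ n) := by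
    rw [map_mul, map_inv, ← conjAbelianization_of, ← div_eq_mul_inv]
    rfl
  have hxw : Additive.ofMul (Abelianization.of x) = w := hx
  refine ⟨x, fun p hp u ⟨k, hk⟩ ⟨l, hl⟩ y => ?_⟩
  obtain ⟨m, hm⟩ := hw p hp ⟨φ u, u, rfl⟩
    ⟨k, Subtype.ext (by rw [SubmonoidClass.coe_pow, ← map_pow, hk, map_one]; rfl)⟩
    ⟨l, by rw [← hxw, htr, hl]; rfl⟩ (Additive.ofMul (Abelianization.of y))
  rw [htr] at hm
  exact ⟨m, hm⟩

end Conjugation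

/-! ### Assembling the theorem -/

/-- Intersections of a Sylow subgroup with conjugates by a suitable element of a nilpotent normal
subgroup with nilpotent quotient. -/
theorem exists_inf_conjSubgroup_le_pCore {G : Type*} [Group G] [Finite G] (N : Subgroup G)
    [N.Normal] [Group.IsNilpotent N] [Group.IsNilpotent (G ⧸ N)] (hodd : Odd (Nat.card G)) :
    ∃ x ∈ N, ∀ p : ℕ, p.Prime → ∀ P : Sylow p G,
      (P : Subgroup G) ⊓ conjSubgroup (P : Subgroup G) x ≤ pCore p G := by
  obtain ⟨x, hx⟩ := exists_regular_conj N hodd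
  refine ⟨x, x.2, fun p hp P u hu => ?_⟩
  have : Fact p.Prime := ⟨hp⟩
  obtain ⟨huP, hux⟩ := hu
  obtain ⟨h, hh, hhu⟩ := (mem_conjSubgroup _ _ _).mp hux
  have hpow : ∀ g ∈ P, ∃ k, g ^ p ^ k = 1 := fun g hg => by
    obtain ⟨k, hk⟩ := P.isPGroup' ⟨g, hg⟩
    exact ⟨k, congrArg Subtype.val hk⟩
  -- Since `u = x⁻¹ * h * x`, this commutator is `u * h⁻¹`.
  have hcomm : u * x * u⁻¹ * (x : G)⁻¹ ∈ P := by
    have h1 : u * x * u⁻¹ * (x : G)⁻¹ = u * h⁻¹ := by rw [← hhu]; group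
    rw [h1]
    exact mul_mem huP (inv_mem hh)
  obtain ⟨S⟩ : Nonempty (Sylow p N) := inferInstance
  have hS : ((S : Subgroup N).map N.subtype).Normal := by
    have : (S : Subgroup N).Characteristic := S.characteristic_of_normal inferInstance
    infer_instance
  refine P.mem_pCore_of_commutator_mem (N := N) huP fun y hy => ?_
  have hmem := MulAut.mul_inv_mem_sylow_of_abelianization S (α := MulAut.conjNormal u) (by
    obtain ⟨k, hk⟩ := hpow u huP
    exact ⟨k, by rw [← map_pow, hk, map_one]⟩)
    (hx p hp u (hpow u huP) (by
      obtain ⟨k, hk⟩ := hpow _ hcomm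
      refine ⟨k, ?_⟩
      rw [← map_pow]
      have : (MulAut.conjNormal u x * x⁻¹ : N) ^ p ^ k = 1 := Subtype.ext (by simpa using hk)
      rw [this, map_one])) ⟨y, hy⟩
  exact (S.isPGroup'.map N.subtype).le_pCore ⟨_, hmem, by simp⟩

theorem mainTheorem1 {G : Type*} [Group G] [Finite G]
    (hG : IsMetanilpotent G) (hodd : Odd (Nat.card G))
    (n : ℕ) (p : Fin n → ℕ) (hp : ∀ i, (p i).Prime) (hinj : Function.Injective p)
    (P : ∀ i, Sylow (p i) G) :
    ∃ x ∈ fittingSubgroup G, ∀ i,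
      (P i : Subgroup G) ⊓ conjSubgroup (P i) x = pCore (p i) G ∧
      Minimal (· ∈ Set.range fun g : G => (P i : Subgroup G) ⊓ conjSubgroup (P i) g)
        ((P i : Subgroup G) ⊓ conjSubgroup (P i) x) := by
  obtain ⟨N, hN, hNnil, hquot⟩ := hG
  obtain ⟨x, hxN, hx⟩ := exists_inf_conjSubgroup_le_pCore N hodd
  refine ⟨x, (le_sSup (show N ∈ {N : Subgroup G | N.Normal ∧ Group.IsNilpotent N} from
    ⟨hN, hNnil⟩) : N ≤ fittingSubgroup G) hxN, fun i => ⟨?_, ⟨x, rfl⟩, ?_⟩⟩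
  · exact le_antisymm (hx _ (hp i) (P i)) (pCore_le_inf_conjSubgroup (P i) x)
  · rintro _ ⟨g, rfl⟩ -
    exact (hx _ (hp i) (P i)).trans (pCore_le_inf_conjSubgroup (P i) g)
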